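/- A topograph $\mathcal T$ is a tree drawn in the plane in which every vertex has degree $3$, together with a real number (label) attached to each of the regions into which the tree divides the plane, such that for every edge, if $s,t$ are the labels of the two regions on either side of the edge and $r,u$ are the labels of the third regions at its two ends, then $r+u=2(s+t)$. If $r,s,t$ are the labels of the three regions meeting at a vertex, the number $$D=2(r^2+s^2+t^2)-(r+s+t)^2$$ is the same at every vertex and is called the discriminant of $\mathcal T$. Theorem. Let $\mathcal T$ be any topograph (in particular, any topograph with integer labels) of discriminant $D<0$. Then $rst\neq 0$ at every vertex, both series below converge, and $$|D|^{3/2}\sum_{v}\frac{1}{|rst|}=4\pi,\qquad\qquad |D|^{5/2}\sum_{v}\frac{|r+s+t|}{|rst|^{2}}=24\pi,$$ where the sums run over all vertices $v$ of $\mathcal T$, each vertex contributing one term, and $r,s,t$ denote the labels of the three regions meeting at $v$. -/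

import Mathlib

/-- A tree drawn in the plane in which every vertex has degree 3, given by its combinatorial
embedding: the abstract graph together with a rotation system. The permutation `rot` sends a
directed edge `d` to the next directed edge, counterclockwise, among those leaving the initial
vertex of `d`. -/
structure PlaneCubicTree (V : Type*) where
  graph : SimpleGraph V
  isTree : graph.IsTree
  degree_eq_three : ∀ v, (graph.neighborSet v).ncard = 3
  rot : Equiv.Perm graph.Dart
  rot_fst : ∀ d, (rot d).fst = d.fst
  rot_cyclic : ∀ d d' : graph.Dart, d.fst = d'.fst → rot.SameCycle d d'

namespace PlaneCubicTree

variable {V : Type*} (T : PlaneCubicTree V)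

/-- Walk along `d` and take the left branch at its end. Repeating this, one follows the border
of the region on the left of `d`. -/
def turnLeft : Equiv.Perm T.graph.Dart :=
  (SimpleGraph.Dart.symm_involutive (G := T.graph)).toPerm.trans T.rot.symm

/-- The regions into which the tree divides the plane: the classes of directed edges that follow
each other, by left turns, along the border of one region (this region being on their left). -/
def Region : Type _ := Quotient (Equiv.Perm.SameCycle.setoid T.turnLeft)

/-- The region on the left of a directed edge. -/
def left (d : T.graph.Dart) : T.Region := Quotient.mk _ d

/-- The region on the right of a directed edge. -/
def right (d : T.graph.Dart) : T.Region := T.left d.symm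

/-- The region that meets the initial vertex of `d` but does not border `d`. -/
def behind (d : T.graph.Dart) : T.Region := T.left (T.rot d)

/-- The region that meets the end vertex of `d` but does not border `d`. -/
def ahead (d : T.graph.Dart) : T.Region := T.behind d.symm

theorem finite_outDarts (v : V) : {d : T.graph.Dart | d.fst = v}.Finite := by
  have hfin : (T.graph.neighborSet v).Finite :=
    Set.finite_of_ncard_ne_zero (by rw [T.degree_eq_three v]; norm_num)
  refine Set.Finite.of_finite_image (f := fun d => d.snd) (hfin.subset ?_) ?_
  · rintro _ ⟨d, rfl, rfl⟩
    exact d.adj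
  · intro d hd d' hd' h
    exact SimpleGraph.Dart.ext _ _ (Prod.ext (Eq.trans hd (Eq.symm hd')) h)

/-- The three directed edges leaving the vertex `v`. As `d` runs over them, `T.left d` runs over
the three regions that meet at `v`. -/
noncomputable def outDarts (v : V) : Finset T.graph.Dart := (T.finite_outDarts v).toFinset

theorem mem_outDarts {v : V} {d : T.graph.Dart} : d ∈ T.outDarts v ↔ d.fst = v := by
  simp [outDarts]

theorem card_outDarts (v : V) : (T.outDarts v).card = 3 := by
  rw [← T.degree_eq_three v, ← Set.ncard_coe_finset]
  refine Set.ncard_congr (fun d _ => d.snd) ?_ ?_ ?_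
  · intro d hd
    have := T.mem_outDarts.1 (Finset.mem_coe.1 hd)
    subst this
    exact d.adj
  · intro d d' hd hd' h
    have h1 := T.mem_outDarts.1 (Finset.mem_coe.1 hd)
    have h2 := T.mem_outDarts.1 (Finset.mem_coe.1 hd')
    exact SimpleGraph.Dart.ext _ _ (Prod.ext (h1.trans h2.symm) h)
  · intro w hw
    exact ⟨⟨(v, w), hw⟩, by simp [mem_outDarts], rfl⟩

theorem isCycleOn_rot (v : V) : T.rot.IsCycleOn (T.outDarts v) := by
  refine ⟨⟨?_, T.rot.injective.injOn, ?_⟩, ?_⟩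
  · intro d hd
    simp only [Finset.mem_coe, mem_outDarts] at hd ⊢
    rw [T.rot_fst, hd]
  · intro d hd
    simp only [Finset.mem_coe, mem_outDarts] at hd
    refine ⟨T.rot.symm d, ?_, by simp⟩
    simp only [Finset.mem_coe, mem_outDarts]
    rw [← T.rot_fst, Equiv.apply_symm_apply, hd]
  · intro d hd d' hd'
    simp only [Finset.mem_coe, mem_outDarts] at hd hd'
    exact T.rot_cyclic d d' (hd.trans hd'.symm)

theorem rot_rot_rot (d : T.graph.Dart) : T.rot (T.rot (T.rot d)) = d := by
  have h := (T.isCycleOn_rot d.fst).pow_card_apply (T.mem_outDarts.2 (rfl : d.fst = d.fst))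
  rw [card_outDarts] at h
  simpa [pow_succ] using h

/-- The region on the right of `d`, met at the initial vertex of `d`. -/
theorem right_eq (d : T.graph.Dart) : T.right d = T.left (T.rot (T.rot d)) := by
  refine Quotient.sound ⟨1, ?_⟩
  have : T.rot.symm d = T.rot (T.rot d) := by
    rw [Equiv.symm_apply_eq, rot_rot_rot]
  simpa [turnLeft] using this

theorem sum_outDarts (d : T.graph.Dart) (f : T.graph.Dart → ℝ) :
    ∑ e ∈ T.outDarts d.fst, f e = f d + f (T.rot d) + f (T.rot (T.rot d)) := by
  classical
  have hd := T.mem_outDarts.2 (rfl : d.fst = d.fst)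
  have himg : T.outDarts d.fst = (Finset.range 3).image (fun n => (T.rot ^ n) d) := by
    ext e
    rw [Finset.mem_image]
    constructor
    · intro he
      obtain ⟨n, hn, h⟩ := (T.isCycleOn_rot d.fst).exists_pow_eq hd he
      rw [card_outDarts] at hn
      exact ⟨n, Finset.mem_range.2 hn, h⟩
    · rintro ⟨n, -, rfl⟩
      exact ((T.isCycleOn_rot d.fst).1.mapsTo.perm_pow n) hd
  have hinj : Set.InjOn (fun n => (T.rot ^ n) d) (Finset.range 3 : Set ℕ) := by
    rw [← Finset.card_image_iff, ← himg, card_outDarts, Finset.card_range]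
  rw [himg, Finset.sum_image hinj]
  simp [Finset.sum_range_succ, pow_succ]

end PlaneCubicTree

/-- A topograph: a plane tree with all vertices of degree 3, with a real label on each region,
such that whenever a directed edge separates regions labelled `s` and `t`, and the third regions
at its two ends are labelled `r` and `u`, one has `r + u = 2 (s + t)`. -/
structure Topograph (V : Type*) extends PlaneCubicTree V where
  label : toPlaneCubicTree.Region → ℝ
  rule : ∀ d : graph.Dart,
    label (toPlaneCubicTree.behind d) + label (toPlaneCubicTree.ahead d) =
      2 * (label (toPlaneCubicTree.left d) + label (toPlaneCubicTree.right d))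

namespace Topograph

variable {V : Type*} (T : Topograph V)

/-- The sum `r + s + t` of the labels of the three regions meeting at `v`. -/
noncomputable def vertexSum (v : V) : ℝ := ∑ d ∈ T.outDarts v, T.label (T.left d)

/-- The sum `r ^ 2 + s ^ 2 + t ^ 2` for the labels of the three regions meeting at `v`. -/
noncomputable def vertexSqSum (v : V) : ℝ := ∑ d ∈ T.outDarts v, T.label (T.left d) ^ 2

/-- The product `r * s * t` of the labels of the three regions meeting at `v`. -/
noncomputable def vertexProd (v : V) : ℝ := ∏ d ∈ T.outDarts v, T.label (T.left d)

/-- The quantity `2 (r ^ 2 + s ^ 2 + t ^ 2) - (r + s + t) ^ 2` at the vertex `v`. -/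
noncomputable def discrAt (v : V) : ℝ := 2 * T.vertexSqSum v - T.vertexSum v ^ 2

theorem discrAt_fst_eq_snd (d : T.graph.Dart) : T.discrAt d.fst = T.discrAt d.snd := by
  have h := T.rule d
  have h1 := T.right_eq d
  have h2 := T.right_eq d.symm
  have h3 : T.right d.symm = T.left d := by
    rw [PlaneCubicTree.right, SimpleGraph.Dart.symm_symm]
  have e : d.snd = d.symm.fst := rfl
  rw [e]
  simp only [discrAt, vertexSum, vertexSqSum, PlaneCubicTree.sum_outDarts]
  rw [← h1, ← h2, h3]
  simp only [PlaneCubicTree.behind, PlaneCubicTree.ahead] at h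
  rw [← PlaneCubicTree.right]
  rw [← eq_sub_iff_add_eq'] at h
  rw [h]
  ring

/-- The discriminant expression takes the same value at all vertices. -/
theorem discrAt_eq (v w : V) : T.discrAt v = T.discrAt w := by
  obtain ⟨p⟩ := T.isTree.connected.preconnected v w
  induction p with
  | nil => rfl
  | cons h _ ih => exact (T.discrAt_fst_eq_snd ⟨(_, _), h⟩).trans ih

/-- The discriminant of a topograph: the common value of `discrAt` at all vertices. -/
noncomputable def discr : ℝ := T.discrAt T.isTree.connected.nonempty.some

theorem discrAt_eq_discr (v : V) : T.discrAt v = T.discr := T.discrAt_eq v _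

end Topograph

/-!
Write `h = s + t - r` for a directed edge with labels `s`, `t` on its sides and `r` behind it. By
the topograph rule, `h` changes sign when the edge is reversed, and `h² - 4st = D`. As `D < 0`, any
two adjacent labels have the same sign, so all labels may be replaced by their absolute values. Let
`A ∈ (0, π)` be the angle with `cot A = h / √|D|` (`Topograph.angle`). Reversing an edge replaces
`A` by `π - A`, and the angles of the three edges leaving a vertex have sum `π`
(`Topograph.sum_angle`): in terms of the quadratic form behind the topograph, they are the angles
between neighbouring vectors of a superbase, up to the signs of the vectors. In these angles the
terms of both series are sums over the edges leaving `v`: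
`|D|^(3/2) / |rst| = ∑ 2 sin 2A` and
`|D|^(5/2) |r + s + t| / |rst|² = ∑ (16 sin 2A - 2 sin 4A)`
(`Topograph.sum_two_mul_sin_angle`, `Topograph.sum_sin_angle_sub_sin_angle`).

The functions `g` of `A` on the right change sign under `A ↦ π - A`, so the sum over a ball around a
root telescopes to the sum of `g(A)` over the edges that leave the ball
(`PlaneCubicTree.sum_rootBall_sum_outDarts`). The angles of these edges always have total `π`,
because the angle of an edge pointing away from the root is the sum of the angles of the two edges
that continue it (`Topograph.sum_frontier_angle`). They also tend to `0` uniformly: the absolute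
values of the labels, being values of a positive definite form at nonzero integer vectors, are
bounded below by some `m > 0` (`Topograph.exists_pos_le_absLabel`), and `h` grows by at least `2m`
at each step away from the root (`Topograph.exists_linear_le_slope`). So `g` may be replaced by its
linear part at `0`, and the sums over balls tend to `g'(0) π`, which is `4π` and `24π`
respectively. The terms being nonnegative, this is the sum of the series.
-/

open Filter Topology

/-! ### Directed edges around a vertex and connectedness -/

namespace PlaneCubicTree

variable {V : Type*} (T : PlaneCubicTree V)

theorem prod_outDarts (d : T.graph.Dart) (f : T.graph.Dart → ℝ) :
    ∏ e ∈ T.outDarts d.fst, f e = f d * f (T.rot d) * f (T.rot (T.rot d)) := by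
  classical
  have hd := T.mem_outDarts.2 (rfl : d.fst = d.fst)
  have himg : T.outDarts d.fst = (Finset.range 3).image (fun n => (T.rot ^ n) d) := by
    ext e
    rw [Finset.mem_image]
    constructor
    · intro he
      obtain ⟨n, hn, h⟩ := (T.isCycleOn_rot d.fst).exists_pow_eq hd he
      rw [card_outDarts] at hn
      exact ⟨n, Finset.mem_range.2 hn, h⟩
    · rintro ⟨n, -, rfl⟩
      exact ((T.isCycleOn_rot d.fst).1.mapsTo.perm_pow n) hd
  have hinj : Set.InjOn (fun n => (T.rot ^ n) d) (Finset.range 3 : Set ℕ) := by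
    rw [← Finset.card_image_iff, ← himg, card_outDarts, Finset.card_range]
  rw [himg, Finset.prod_image hinj]
  simp [Finset.prod_range_succ, pow_succ]

theorem eq_rot_or_eq_rot_rot {d e : T.graph.Dart} (h : e.fst = d.fst) (hne : e ≠ d) :
    e = T.rot d ∨ e = T.rot (T.rot d) := by
  obtain ⟨n, hn, rfl⟩ := (T.isCycleOn_rot d.fst).exists_pow_eq (T.mem_outDarts.2 rfl)
    (T.mem_outDarts.2 h)
  rw [card_outDarts] at hn
  interval_cases n
  · simp at hne
  · simp
  · simp [pow_succ]

theorem exists_dart_fst_eq (v : V) : ∃ d : T.graph.Dart, d.fst = v := by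
  have : (T.outDarts v).Nonempty := by
    rw [← Finset.card_pos, T.card_outDarts]
    norm_num
  obtain ⟨d, hd⟩ := this
  exact ⟨d, T.mem_outDarts.1 hd⟩

/-- A property of directed edges that is stable under reversal and rotation, and holds for one
directed edge, holds for all of them. -/
@[elab_as_elim]
theorem forall_dart_of_symm_of_rot {P : T.graph.Dart → Prop} (hs : ∀ d, P d → P d.symm)
    (hr : ∀ d, P d → P (T.rot d)) {d₀ : T.graph.Dart} (h₀ : P d₀) (d : T.graph.Dart) : P d := by
  have key : ∀ d e : T.graph.Dart, P d → d.fst = e.fst → P e := by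
    intro d e hd he
    obtain ⟨n, -, rfl⟩ := (T.isCycleOn_rot d.fst).exists_pow_eq (T.mem_outDarts.2 rfl)
      (T.mem_outDarts.2 he.symm)
    clear he
    induction n with
    | zero => simpa using hd
    | succ n ih => rw [pow_succ', Equiv.Perm.mul_apply]; exact hr _ ih
  have step : ∀ v w : V, T.graph.Walk v w → (∀ e : T.graph.Dart, e.fst = v → P e) →
      ∀ e : T.graph.Dart, e.fst = w → P e := by
    intro v w p
    induction p with
    | nil => exact id
    | cons h _ ih =>
      refine fun hP => ih fun e he => ?_
      exact key _ e (hs _ (hP ⟨(_, _), h⟩ rfl)) he.symm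
  obtain ⟨p⟩ := T.isTree.connected.preconnected d₀.fst d.fst
  exact step _ _ p (fun e he => key _ e h₀ he.symm) d rfl

/-! ### Distance from a root -/

open Classical in
/-- The directed edges that lead from distance `n` to distance `n + 1` from the root `o`: those
leaving `o`, and then at each step the non-backtracking continuations of the previous ones. -/
noncomputable def frontier (o : V) : ℕ → Finset T.graph.Dart
  | 0 => T.outDarts o
  | n + 1 => (frontier o n).biUnion fun d => (T.outDarts d.snd).erase d.symm

open Classical in
/-- The vertices at distance at most `n` from the root `o`. -/
noncomputable def rootBall (o : V) : ℕ → Finset V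
  | 0 => {o}
  | n + 1 => rootBall o n ∪ (T.frontier o n).image fun d => d.snd

theorem eq_of_snd_eq_of_dist {o : V} {d e : T.graph.Dart} (h : d.snd = e.snd)
    (hd : T.graph.dist o d.snd = T.graph.dist o d.fst + 1)
    (he : T.graph.dist o e.snd = T.graph.dist o e.fst + 1) : d = e := by
  obtain ⟨⟨a, b⟩, hab⟩ := d
  obtain ⟨⟨c, b'⟩, hcb⟩ := e
  obtain rfl : b = b' := h
  simp only at hd he
  obtain ⟨p, hp, hpl⟩ := T.isTree.connected.exists_path_of_dist o a
  obtain ⟨q, hq, hql⟩ := T.isTree.connected.exists_path_of_dist o c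
  have hp' : (p.concat hab).IsPath := by
    apply SimpleGraph.Walk.isPath_of_length_eq_dist
    rw [SimpleGraph.Walk.length_concat, hpl, hd]
  have hq' : (q.concat hcb).IsPath := by
    apply SimpleGraph.Walk.isPath_of_length_eq_dist
    rw [SimpleGraph.Walk.length_concat, hql, he]
  have huniq := (T.isTree.existsUnique_path o b).unique hp' hq'
  have h2 := congrArg (fun w => SimpleGraph.Walk.penultimate w) huniq
  simp only [SimpleGraph.Walk.penultimate_concat] at h2
  subst h2
  rfl

theorem exists_dart_of_dist_eq_succ {o v : V} {n : ℕ} (h : T.graph.dist o v = n + 1) :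
    ∃ d : T.graph.Dart, d.snd = v ∧ T.graph.dist o d.fst = n := by
  obtain ⟨p, hp⟩ := T.isTree.connected.exists_walk_length_eq_dist o v
  have hnil : ¬ p.Nil := by
    rw [← SimpleGraph.Walk.length_eq_zero_iff]
    omega
  have hadj := p.adj_penultimate hnil
  have hle := SimpleGraph.dist_le p.dropLast
  rw [p.length_dropLast, hp, h, Nat.add_sub_cancel] at hle
  have h4 := T.isTree.dist_eq_dist_add_one_of_adj o hadj
  refine ⟨⟨(_, _), hadj⟩, rfl, ?_⟩
  change T.graph.dist o p.penultimate = n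
  change T.graph.dist o p.penultimate ≤ n at hle
  omega

theorem mem_frontier {o : V} {n : ℕ} {d : T.graph.Dart} :
    d ∈ T.frontier o n ↔ T.graph.dist o d.fst = n ∧ T.graph.dist o d.snd = n + 1 := by
  induction n generalizing d with
  | zero =>
    rw [frontier, mem_outDarts, T.isTree.connected.dist_eq_zero_iff, eq_comm]
    refine ⟨fun h => ⟨h, ?_⟩, fun h => h.1⟩
    rw [h]
    exact SimpleGraph.dist_eq_one_iff_adj.2 d.adj
  | succ n ih =>
    simp only [frontier, Finset.mem_biUnion, Finset.mem_erase, mem_outDarts, ih]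
    constructor
    · rintro ⟨e, ⟨he1, he2⟩, hne, hfst⟩
      refine ⟨by rw [hfst, he2], ?_⟩
      rcases T.isTree.dist_eq_dist_add_one_of_adj o d.adj with h | h
      · refine absurd ?_ hne
        rw [← SimpleGraph.Dart.symm_symm d]
        congr 1
        exact T.eq_of_snd_eq_of_dist (o := o) hfst h (he2.trans (by rw [he1]))
      · rw [h, hfst, he2]
    · rintro ⟨h1, h2⟩
      obtain ⟨e, he, hen⟩ := T.exists_dart_of_dist_eq_succ h1
      refine ⟨e, ⟨hen, by rw [he, h1]⟩, ?_, he.symm⟩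
      rintro rfl
      rw [show e.symm.snd = e.fst from rfl] at h2
      omega

theorem mem_rootBall {o : V} {n : ℕ} {v : V} : v ∈ T.rootBall o n ↔ T.graph.dist o v ≤ n := by
  induction n generalizing v with
  | zero =>
    rw [rootBall, Finset.mem_singleton, Nat.le_zero, T.isTree.connected.dist_eq_zero_iff, eq_comm]
  | succ n ih =>
    simp only [rootBall, Finset.mem_union, ih, Finset.mem_image, mem_frontier]
    constructor
    · rintro (h | ⟨d, ⟨-, h⟩, rfl⟩)
      · omega
      · exact h.le
    · intro h
      rcases Nat.le_succ_iff.1 h with h | h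
      · exact Or.inl h
      right
      obtain ⟨e, he, hen⟩ := T.exists_dart_of_dist_eq_succ h
      exact ⟨e, ⟨hen, by rw [he, h]⟩, he⟩

theorem sum_frontier_succ (o : V) (n : ℕ) (f : T.graph.Dart → ℝ) :
    ∑ e ∈ T.frontier o (n + 1), f e =
      ∑ d ∈ T.frontier o n, (∑ e ∈ T.outDarts d.snd, f e - f d.symm) := by
  classical
  rw [frontier, Finset.sum_biUnion]
  · refine Finset.sum_congr rfl fun d _ => ?_
    have hd : d.symm ∈ T.outDarts d.snd := T.mem_outDarts.2 rfl
    rw [← Finset.sum_erase_add _ f hd, add_sub_cancel_right]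
  · intro d hd d' hd' hne
    rw [Function.onFun, Finset.disjoint_left]
    intro e he he'
    rw [Finset.mem_erase, mem_outDarts] at he he'
    rw [Finset.mem_coe, mem_frontier] at hd hd'
    exact hne (T.eq_of_snd_eq_of_dist (he.2.symm.trans he'.2) (hd.2.trans (by rw [hd.1]))
      (hd'.2.trans (by rw [hd'.1])))

theorem sum_rootBall_succ (o : V) (n : ℕ) (F : V → ℝ) :
    ∑ v ∈ T.rootBall o (n + 1), F v =
      ∑ v ∈ T.rootBall o n, F v + ∑ d ∈ T.frontier o n, F d.snd := by
  classical
  rw [rootBall, Finset.sum_union, Finset.sum_image]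
  · intro d hd e he h
    rw [Finset.mem_coe, mem_frontier] at hd he
    exact T.eq_of_snd_eq_of_dist h (hd.2.trans (by rw [hd.1])) (he.2.trans (by rw [he.1]))
  · rw [Finset.disjoint_left]
    intro v hv hv'
    obtain ⟨d, hd, rfl⟩ := Finset.mem_image.1 hv'
    rw [mem_rootBall] at hv
    rw [mem_frontier] at hd
    omega

/-! ### Telescoping sums over balls -/

/-- A discrete divergence theorem: if `f` changes sign under reversal of edges, then the sum over
a ball of its divergence is its flux through the frontier. -/
theorem sum_rootBall_sum_outDarts (o : V) (n : ℕ) (f : T.graph.Dart → ℝ)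
    (hf : ∀ d, f d.symm = -f d) :
    ∑ v ∈ T.rootBall o n, ∑ d ∈ T.outDarts v, f d = ∑ d ∈ T.frontier o n, f d := by
  induction n with
  | zero => simp [rootBall, frontier]
  | succ n ih =>
    rw [sum_rootBall_succ, ih, sum_frontier_succ, ← Finset.sum_add_distrib]
    refine Finset.sum_congr rfl fun d _ => ?_
    rw [hf]
    ring

theorem hasSum_sum_outDarts (o : V) (f : T.graph.Dart → ℝ) (hf : ∀ d, f d.symm = -f d)
    (hpos : ∀ v, 0 ≤ ∑ d ∈ T.outDarts v, f d) {L : ℝ}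
    (hL : Tendsto (fun n => ∑ d ∈ T.frontier o n, f d) atTop (𝓝 L)) :
    HasSum (fun v => ∑ d ∈ T.outDarts v, f d) L := by
  simp only [← T.sum_rootBall_sum_outDarts o _ f hf] at hL
  have hmono : Monotone fun n => ∑ v ∈ T.rootBall o n, ∑ d ∈ T.outDarts v, f d := by
    intro m n hmn
    refine Finset.sum_le_sum_of_subset_of_nonneg ?_ fun v _ _ => hpos v
    intro v hv
    rw [mem_rootBall] at hv ⊢
    omega
  refine hasSum_of_isLUB_of_nonneg L hpos ⟨?_, ?_⟩
  · rintro _ ⟨s, rfl⟩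
    have hs : s ⊆ T.rootBall o (s.sup (T.graph.dist o)) := fun v hv =>
      T.mem_rootBall.2 (Finset.le_sup (f := T.graph.dist o) hv)
    exact (Finset.sum_le_sum_of_subset_of_nonneg hs fun v _ _ => hpos v).trans
      (hmono.ge_of_tendsto hL _)
  · intro b hb
    exact le_of_tendsto' hL fun n => hb ⟨_, rfl⟩

end PlaneCubicTree

/-! ### Sums of arctangents and of small quantities -/

theorem arctan_add_add_eq_pi_div_two {x y z : ℝ} (h : x * y + y * z + z * x = 1)
    (hxy : 0 < x + y) (hyz : 0 < y + z) (hzx : 0 < z + x) :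
    Real.arctan x + Real.arctan y + Real.arctan z = Real.pi / 2 := by
  have hs : ∀ t, Real.sin (Real.arctan t) = t * Real.cos (Real.arctan t) := fun t => by
    rw [Real.sin_arctan, Real.cos_arctan]
    ring
  have hcos : Real.cos (Real.arctan x + Real.arctan y + Real.arctan z) = 0 := by
    rw [Real.cos_add, Real.cos_add, Real.sin_add, hs, hs, hs]
    linear_combination (-Real.cos (Real.arctan x) * Real.cos (Real.arctan y) *
      Real.cos (Real.arctan z)) * h
  have hadd : ∀ {a b : ℝ}, 0 < a + b → 0 < Real.arctan a + Real.arctan b := fun {a b} hab => by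
    have := Real.arctan_strictMono (show -b < a by linarith)
    rw [Real.arctan_neg] at this
    linarith
  have h1 := hadd hxy
  have h2 := hadd hyz
  have h3 := hadd hzx
  have hx := Real.arctan_lt_pi_div_two x
  have hy := Real.arctan_lt_pi_div_two y
  have hz := Real.arctan_lt_pi_div_two z
  -- The sum lies in `(0, 3π/2)`, where the cosine vanishes only at `π/2`.
  rcases lt_trichotomy (Real.arctan x + Real.arctan y + Real.arctan z)
    (Real.pi / 2) with hlt | heq | hgt
  · exact absurd hcos (Real.cos_pos_of_mem_Ioo ⟨by linarith, hlt⟩).ne'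
  · exact heq
  · exact absurd hcos (Real.cos_neg_of_pi_div_two_lt_of_lt hgt (by linarith)).ne

/-- If nonnegative weights of constant total `c` become uniformly small, then a function `g` with
`g 0 = 0` may be replaced by its linear part when summed over them. -/
theorem tendsto_sum_comp_of_hasDerivAt {ι : Type*} {g : ℝ → ℝ} {K c : ℝ} (hg : HasDerivAt g K 0)
    (hg0 : g 0 = 0) {E : ℕ → Finset ι} {A : ι → ℝ} (hA : ∀ i, 0 ≤ A i)
    (hsum : ∀ n, ∑ i ∈ E n, A i = c) {b : ℕ → ℝ} (hb : Tendsto b atTop (𝓝 0))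
    (hAb : ∀ n, ∀ i ∈ E n, A i ≤ b n) :
    Tendsto (fun n => ∑ i ∈ E n, g (A i)) atTop (𝓝 (K * c)) := by
  have hc : 0 ≤ c := hsum 0 ▸ Finset.sum_nonneg fun i _ => hA i
  rw [Metric.tendsto_atTop]
  intro ε hε
  have hlin := (hasDerivAt_iff_isLittleO.1 hg).def (show 0 < ε / (c + 1) by positivity)
  obtain ⟨δ, hδ, hball⟩ := Metric.eventually_nhds_iff.1 hlin
  obtain ⟨N, hN⟩ := Metric.tendsto_atTop.1 hb δ hδ
  refine ⟨N, fun n hn => ?_⟩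
  have hterm : ∀ i ∈ E n, |g (A i) - K * A i| ≤ ε / (c + 1) * A i := by
    intro i hi
    have hlt : A i < δ := (hAb n i hi).trans_lt ((le_abs_self _).trans_lt (by
      simpa [Real.dist_eq] using hN n hn))
    have := hball (y := A i) (by rwa [Real.dist_eq, sub_zero, abs_of_nonneg (hA i)])
    simpa [hg0, abs_of_nonneg (hA i), mul_comm] using this
  rw [Real.dist_eq, ← hsum n, Finset.mul_sum, ← Finset.sum_sub_distrib]
  calc |∑ i ∈ E n, (g (A i) - K * A i)| ≤ ∑ i ∈ E n, |g (A i) - K * A i| :=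
        Finset.abs_sum_le_sum_abs _ _
    _ ≤ ∑ i ∈ E n, ε / (c + 1) * A i := Finset.sum_le_sum hterm
    _ = ε / (c + 1) * c := by rw [← Finset.mul_sum, hsum]
    _ < ε := by
        rw [div_mul_eq_mul_div, div_lt_iff₀ (by positivity)]
        linarith

/-! ### Labels in absolute value -/

namespace Topograph

variable {V : Type*} (T : Topograph V)

theorem label_left_rot_rot (d : T.graph.Dart) :
    T.label (T.left (T.rot (T.rot d))) = T.label (T.left d.symm) := by
  rw [← T.right_eq, PlaneCubicTree.right]

theorem label_left_rot_symm (d : T.graph.Dart) :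
    T.label (T.left (T.rot d).symm) = T.label (T.left d) := by
  rw [← label_left_rot_rot, T.rot_rot_rot]

theorem discr_eq (d : T.graph.Dart) :
    T.discr = (T.label (T.left d) + T.label (T.left d.symm) - T.label (T.left (T.rot d))) ^ 2 -
      4 * (T.label (T.left d) * T.label (T.left d.symm)) := by
  rw [← T.discrAt_eq_discr d.fst, discrAt, vertexSqSum, vertexSum, T.sum_outDarts, T.sum_outDarts,
    label_left_rot_rot]
  ring

theorem label_mul_label_symm_pos (hD : T.discr < 0) (d : T.graph.Dart) :
    0 < T.label (T.left d) * T.label (T.left d.symm) := by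
  have := T.discr_eq d
  nlinarith [sq_nonneg (T.label (T.left d) + T.label (T.left d.symm) - T.label (T.left (T.rot d)))]

/-- The absolute value of the label on the left of a directed edge. When the discriminant is
negative, all labels have the same sign, so that these numbers again form a topograph. -/
noncomputable def absLabel (d : T.graph.Dart) : ℝ := |T.label (T.left d)|

/-- Half the increase of the third label along a directed edge `d`, for labels taken in absolute
value: if these are `s` and `t` on the sides of `d`, then they are `s + t - h` behind `d` and
`s + t + h` ahead of it. -/
noncomputable def slope (d : T.graph.Dart) : ℝ :=
  T.absLabel d + T.absLabel d.symm - T.absLabel (T.rot d)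

theorem absLabel_rot_rot (d : T.graph.Dart) :
    T.absLabel (T.rot (T.rot d)) = T.absLabel d.symm := by
  rw [absLabel, label_left_rot_rot, absLabel]

theorem absLabel_rot_symm (d : T.graph.Dart) : T.absLabel (T.rot d).symm = T.absLabel d := by
  rw [absLabel, label_left_rot_symm, absLabel]

theorem slope_rot (d : T.graph.Dart) :
    T.slope (T.rot d) = T.absLabel (T.rot d) + T.absLabel d - T.absLabel d.symm := by
  rw [slope, absLabel_rot_rot, absLabel_rot_symm]

theorem slope_rot_rot (d : T.graph.Dart) :
    T.slope (T.rot (T.rot d)) = T.absLabel d.symm + T.absLabel (T.rot d) - T.absLabel d := by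
  rw [slope, T.rot_rot_rot, absLabel_rot_rot, absLabel_rot_symm]

theorem absLabel_pos (hD : T.discr < 0) (d : T.graph.Dart) : 0 < T.absLabel d :=
  abs_pos.2 (left_ne_zero_of_mul (T.label_mul_label_symm_pos hD d).ne')

/-- The three labels around a vertex all have the same sign. -/
theorem exists_sign_around_vertex (hD : T.discr < 0) (d : T.graph.Dart) :
    ∃ ε : ℝ, (ε = 1 ∨ ε = -1) ∧ T.label (T.left d) = ε * T.absLabel d ∧
      T.label (T.left d.symm) = ε * T.absLabel d.symm ∧
      T.label (T.left (T.rot d)) = ε * T.absLabel (T.rot d) := by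
  have h1 := T.label_mul_label_symm_pos hD d
  have h2 := T.label_mul_label_symm_pos hD (T.rot d)
  rw [label_left_rot_symm] at h2
  simp only [absLabel]
  rcases lt_or_ge 0 (T.label (T.left d)) with h | h
  · refine ⟨1, Or.inl rfl, ?_, ?_, ?_⟩ <;> rw [abs_of_pos, one_mul]
    · exact h
    · exact (pos_iff_pos_of_mul_pos h1).1 h
    · exact (pos_iff_pos_of_mul_pos h2).2 h
  · have h' : T.label (T.left d) < 0 := lt_of_le_of_ne h (left_ne_zero_of_mul h1.ne')
    refine ⟨-1, Or.inr rfl, ?_, ?_, ?_⟩ <;> rw [abs_of_neg, neg_mul_neg, one_mul]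
    · exact h'
    · exact (neg_iff_neg_of_mul_pos h1).1 h'
    · exact (neg_iff_neg_of_mul_pos h2).2 h'

theorem slope_sq (hD : T.discr < 0) (d : T.graph.Dart) :
    T.slope d ^ 2 = 4 * (T.absLabel d * T.absLabel d.symm) + T.discr := by
  obtain ⟨ε, hε, h1, h2, h3⟩ := T.exists_sign_around_vertex hD d
  have hε2 : ε ^ 2 = 1 := by rcases hε with rfl | rfl <;> norm_num
  rw [T.discr_eq d, slope, h1, h2, h3]
  linear_combination (4 * (T.absLabel d * T.absLabel d.symm) -
    (T.absLabel d + T.absLabel d.symm - T.absLabel (T.rot d)) ^ 2) * hε2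

theorem slope_symm (hD : T.discr < 0) (d : T.graph.Dart) : T.slope d.symm = -T.slope d := by
  obtain ⟨ε, hε, h1, h2, h3⟩ := T.exists_sign_around_vertex hD d
  obtain ⟨η, hη, h1', h2', h3'⟩ := T.exists_sign_around_vertex hD d.symm
  have hrule := T.rule d
  simp only [PlaneCubicTree.behind, PlaneCubicTree.ahead, PlaneCubicTree.right] at hrule
  have hpos := T.absLabel_pos hD d.symm
  have hεη : ε = η := mul_right_cancel₀ hpos.ne' (h2.symm.trans h1')
  have hε2 : ε ^ 2 = 1 := by rcases hε with rfl | rfl <;> norm_num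
  rw [h1, h2, h3, h3', ← hεη] at hrule
  rw [slope, slope, SimpleGraph.Dart.symm_symm]
  have hε0 : ε ≠ 0 := by rcases hε with rfl | rfl <;> norm_num
  apply mul_left_cancel₀ hε0
  linear_combination -hrule

theorem abs_vertexProd_fst (d : T.graph.Dart) :
    |T.vertexProd d.fst| = T.absLabel d * T.absLabel (T.rot d) * T.absLabel d.symm := by
  rw [vertexProd, T.prod_outDarts, abs_mul, abs_mul, label_left_rot_rot]
  rfl

theorem abs_vertexSum_fst (hD : T.discr < 0) (d : T.graph.Dart) :
    |T.vertexSum d.fst| = T.absLabel d + T.absLabel (T.rot d) + T.absLabel d.symm := by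
  obtain ⟨ε, hε, h1, h2, h3⟩ := T.exists_sign_around_vertex hD d
  have hε1 : |ε| = 1 := by rcases hε with rfl | rfl <;> norm_num
  have p1 := T.absLabel_pos hD d
  have p2 := T.absLabel_pos hD d.symm
  have p3 := T.absLabel_pos hD (T.rot d)
  rw [vertexSum, T.sum_outDarts, label_left_rot_rot, h1, h2, h3, ← mul_add, ← mul_add, abs_mul,
    hε1, one_mul, abs_of_pos (by positivity)]

/-! ### Angles of directed edges -/

/-- The angle, in `(0, π)`, whose cotangent is `slope d / √|D|`. If the labels are the values of a
positive definite quadratic form on vectors of a lattice, it is the angle between the vectors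
attached to the two sides of `d`. -/
noncomputable def angle (d : T.graph.Dart) : ℝ :=
  Real.pi / 2 - Real.arctan (T.slope d / √(-T.discr))

theorem angle_nonneg (d : T.graph.Dart) : 0 ≤ T.angle d :=
  sub_nonneg.2 (Real.arctan_lt_pi_div_two _).le

theorem angle_symm (hD : T.discr < 0) (d : T.graph.Dart) :
    T.angle d.symm = Real.pi - T.angle d := by
  rw [angle, angle, T.slope_symm hD, neg_div, Real.arctan_neg]
  ring

theorem sum_angle (hD : T.discr < 0) (v : V) : ∑ d ∈ T.outDarts v, T.angle d = Real.pi := by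
  obtain ⟨d, rfl⟩ := T.exists_dart_fst_eq v
  have hΔ : 0 < √(-T.discr) := Real.sqrt_pos.2 (by linarith)
  have hsq : √(-T.discr) ^ 2 = -T.discr := Real.sq_sqrt (by linarith)
  have p1 := T.absLabel_pos hD d
  have p2 := T.absLabel_pos hD d.symm
  have p3 := T.absLabel_pos hD (T.rot d)
  have hsl := T.slope_sq hD d
  rw [T.sum_outDarts]
  have := arctan_add_add_eq_pi_div_two (x := T.slope d / √(-T.discr))
    (y := T.slope (T.rot d) / √(-T.discr)) (z := T.slope (T.rot (T.rot d)) / √(-T.discr))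
    (by
      field_simp
      rw [slope_rot, slope_rot_rot, hsq]
      rw [slope] at hsl ⊢
      linear_combination -hsl)
    (by rw [← add_div, slope_rot, slope]; apply div_pos _ hΔ; linarith)
    (by rw [← add_div, slope_rot, slope_rot_rot]; apply div_pos _ hΔ; linarith)
    (by rw [← add_div, slope_rot_rot, slope]; apply div_pos _ hΔ; linarith)
  simp only [angle]
  linarith

theorem sum_frontier_angle (hD : T.discr < 0) (o : V) (n : ℕ) :
    ∑ d ∈ T.frontier o n, T.angle d = Real.pi := by
  induction n with
  | zero => exact T.sum_angle hD o
  | succ n ih =>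
    rw [T.sum_frontier_succ, ← ih]
    refine Finset.sum_congr rfl fun d _ => ?_
    rw [T.sum_angle hD, T.angle_symm hD]
    ring

/-! ### Growth of the slopes and limits of the sums over the frontier -/

/-- In absolute value, the labels are the values, at primitive integer vectors, of the form read off
at one edge; the pair of vectors attached to the two sides of an edge is a basis of `ℤ²`. -/
theorem exists_int_coords (hD : T.discr < 0) (d₀ d : T.graph.Dart) :
    ∃ x y z w : ℤ, x * w - y * z = 1 ∧
      T.absLabel d = T.absLabel d₀ * x ^ 2 + T.slope d₀ * (x * y) + T.absLabel d₀.symm * y ^ 2 ∧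
      T.absLabel d.symm =
        T.absLabel d₀ * z ^ 2 + T.slope d₀ * (z * w) + T.absLabel d₀.symm * w ^ 2 ∧
      T.slope d = 2 * T.absLabel d₀ * (x * z) + T.slope d₀ * (x * w + y * z) +
        2 * T.absLabel d₀.symm * (y * w) := by
  refine T.forall_dart_of_symm_of_rot ?_ ?_ (d₀ := d₀) ?_ d
  · rintro d ⟨x, y, z, w, h, h1, h2, h3⟩
    refine ⟨z, w, -x, -y, by linear_combination h, h2, ?_, ?_⟩
    · rw [SimpleGraph.Dart.symm_symm, h1]
      push_cast
      ring
    · rw [T.slope_symm hD, h3]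
      push_cast
      ring
  · rintro d ⟨x, y, z, w, h, h1, h2, h3⟩
    have h4 : T.absLabel (T.rot d) = T.absLabel d + T.absLabel d.symm - T.slope d := by
      rw [slope]
      ring
    refine ⟨x - z, y - w, x, y, by linear_combination h, ?_, ?_, ?_⟩
    · rw [h4, h1, h2, h3]
      push_cast
      ring
    · rw [absLabel_rot_symm, h1]
    · rw [slope_rot, h4, h1, h2, h3]
      push_cast
      ring
  · exact ⟨1, 0, 0, 1, by norm_num, by simp, by simp, by simp⟩

theorem exists_pos_le_absLabel (hD : T.discr < 0) (d₀ : T.graph.Dart) :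
    ∃ m, 0 < m ∧ ∀ d, m ≤ T.absLabel d := by
  have hα := T.absLabel_pos hD d₀
  have hsl := T.slope_sq hD d₀
  refine ⟨min (T.absLabel d₀) (-T.discr / (4 * T.absLabel d₀)),
    lt_min hα (div_pos (by linarith) (by linarith)), fun d => ?_⟩
  obtain ⟨x, y, z, w, h, h1, -, -⟩ := T.exists_int_coords hD d₀ d
  rw [h1]
  have hone : ∀ k : ℤ, k ≠ 0 → (1 : ℝ) ≤ (k : ℝ) ^ 2 := fun k hk => by
    have : 0 < k ^ 2 := by positivity
    exact_mod_cast (by omega : 1 ≤ k ^ 2)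
  by_cases hy : y = 0
  · subst hy
    have hx : x ≠ 0 := by
      rintro rfl
      simp at h
    have hx2 := hone x hx
    refine (min_le_left _ _).trans ?_
    push_cast
    nlinarith
  · have hy2 := hone y hy
    refine (min_le_right _ _).trans ?_
    rw [div_le_iff₀ (by linarith)]
    -- Completing the square: `4 α q(x, y) = (2 α x + h y)² + |D| y²`.
    have hsquare := sq_nonneg (2 * T.absLabel d₀ * x + T.slope d₀ * y)
    have hle : -T.discr ≤ -T.discr * (y : ℝ) ^ 2 := le_mul_of_one_le_right (by linarith) hy2
    linear_combination hsquare + hle + (y : ℝ) ^ 2 * hsl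

/-- Each step away from the root adds twice a label to the slope, and the labels are bounded below,
so the slopes grow at least linearly. -/
theorem exists_linear_le_slope (hD : T.discr < 0) (o : V) :
    ∃ m C : ℝ, 0 < m ∧ ∀ n : ℕ, ∀ d ∈ T.frontier o n, C + 2 * m * n ≤ T.slope d := by
  obtain ⟨d₀, -⟩ := T.exists_dart_fst_eq o
  obtain ⟨m, hm, hle⟩ := T.exists_pos_le_absLabel hD d₀
  obtain ⟨C, hC⟩ := ((T.outDarts o).finite_toSet.image T.slope).bddBelow
  refine ⟨m, C, hm, fun n => ?_⟩
  induction n with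
  | zero =>
    intro d hd
    simpa using hC ⟨d, hd, rfl⟩
  | succ n ih =>
    intro e he
    simp only [PlaneCubicTree.frontier, Finset.mem_biUnion, Finset.mem_erase,
      PlaneCubicTree.mem_outDarts] at he
    obtain ⟨d, hd, hne, hfst⟩ := he
    have h1 := ih d hd
    have h2 := T.slope_symm hD d
    have h3 := hle d
    have h4 := hle d.symm
    have h5 := T.absLabel_pos hD d
    have h6 : T.slope d.symm = T.absLabel d.symm + T.absLabel d - T.absLabel (T.rot d.symm) := by
      rw [slope, SimpleGraph.Dart.symm_symm]
    push_cast
    rcases T.eq_rot_or_eq_rot_rot (d := d.symm) hfst hne with rfl | rfl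
    · rw [slope_rot, SimpleGraph.Dart.symm_symm]
      linarith
    · rw [slope_rot_rot, SimpleGraph.Dart.symm_symm]
      linarith

theorem tendsto_sum_frontier (hD : T.discr < 0) (o : V) {g : ℝ → ℝ} {K : ℝ}
    (hg : HasDerivAt g K 0) (hg0 : g 0 = 0) :
    Tendsto (fun n => ∑ d ∈ T.frontier o n, g (T.angle d)) atTop (𝓝 (K * Real.pi)) := by
  obtain ⟨m, C, hm, hle⟩ := T.exists_linear_le_slope hD o
  have hΔ : 0 < √(-T.discr) := Real.sqrt_pos.2 (by linarith)
  refine tendsto_sum_comp_of_hasDerivAt hg hg0 (T.angle_nonneg) (T.sum_frontier_angle hD o)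
    (b := fun n : ℕ => Real.pi / 2 - Real.arctan ((C + 2 * m * n) / √(-T.discr))) ?_ ?_
  · have h1 : Tendsto (fun n : ℕ => (C + 2 * m * n) / √(-T.discr)) atTop atTop :=
      (tendsto_atTop_add_const_left _ _
        (tendsto_natCast_atTop_atTop.const_mul_atTop (by positivity))).atTop_div_const hΔ
    have h2 := ((Real.tendsto_arctan_atTop.mono_right nhdsWithin_le_nhds).comp h1).const_sub
      (Real.pi / 2)
    simpa using h2
  · intro n d hd
    have := Real.arctan_mono (div_le_div_of_nonneg_right (hle n d hd) hΔ.le)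
    simp only [angle]
    linarith

/-- If `g` is odd about `π / 2`, vanishes at `0`, and has nonnegative sums over the angles at each
vertex, then these sums add up to `g'(0) π`. -/
theorem hasSum_sum_comp_angle (hD : T.discr < 0) {g : ℝ → ℝ} {K : ℝ} (hg : HasDerivAt g K 0)
    (hg0 : g 0 = 0) (hodd : ∀ a, g (Real.pi - a) = -g a)
    (hpos : ∀ v, 0 ≤ ∑ d ∈ T.outDarts v, g (T.angle d)) :
    HasSum (fun v => ∑ d ∈ T.outDarts v, g (T.angle d)) (K * Real.pi) :=
  T.hasSum_sum_outDarts T.isTree.connected.nonempty.some (fun d => g (T.angle d))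
    (fun d => by rw [T.angle_symm hD, hodd]) hpos (T.tendsto_sum_frontier hD _ hg hg0)

/-! ### The terms of the two series in terms of angles -/

theorem one_add_slope_div_sq (hD : T.discr < 0) (d : T.graph.Dart) :
    1 + (T.slope d / √(-T.discr)) ^ 2 =
      4 * (T.absLabel d * T.absLabel d.symm) / √(-T.discr) ^ 2 := by
  have hΔ : 0 < √(-T.discr) := Real.sqrt_pos.2 (by linarith)
  have hsq : √(-T.discr) ^ 2 = -T.discr := Real.sq_sqrt (by linarith)
  field_simp
  rw [T.slope_sq hD, hsq]
  ring

theorem sin_two_mul_angle (hD : T.discr < 0) (d : T.graph.Dart) :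
    Real.sin (2 * T.angle d) =
      √(-T.discr) * T.slope d / (2 * (T.absLabel d * T.absLabel d.symm)) := by
  have hΔ : 0 < √(-T.discr) := Real.sqrt_pos.2 (by linarith)
  have hsq : √(-T.discr) ^ 2 = -T.discr := Real.sq_sqrt (by linarith)
  have p1 := T.absLabel_pos hD d
  have p2 := T.absLabel_pos hD d.symm
  have hcos := Real.cos_sq_arctan (T.slope d / √(-T.discr))
  have hsin : Real.sin (Real.arctan (T.slope d / √(-T.discr))) =
      T.slope d / √(-T.discr) * Real.cos (Real.arctan (T.slope d / √(-T.discr))) := by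
    rw [Real.sin_arctan, Real.cos_arctan]
    ring
  rw [angle, Real.sin_two_mul, Real.sin_pi_div_two_sub, Real.cos_pi_div_two_sub, hsin,
    show ∀ c x : ℝ, 2 * c * (x * c) = 2 * x * c ^ 2 by intros; ring, hcos, T.one_add_slope_div_sq hD]
  field_simp
  ring

theorem cos_two_mul_angle (hD : T.discr < 0) (d : T.graph.Dart) :
    Real.cos (2 * T.angle d) = 1 + T.discr / (2 * (T.absLabel d * T.absLabel d.symm)) := by
  have hsq : √(-T.discr) ^ 2 = -T.discr := Real.sq_sqrt (by linarith)
  have p1 := T.absLabel_pos hD d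
  have p2 := T.absLabel_pos hD d.symm
  rw [angle, mul_sub, show 2 * (Real.pi / 2) = Real.pi by ring, Real.cos_pi_sub, Real.cos_two_mul,
    Real.cos_sq_arctan, T.one_add_slope_div_sq hD, hsq]
  field_simp
  ring

theorem sum_two_mul_sin_angle (hD : T.discr < 0) (v : V) :
    ∑ d ∈ T.outDarts v, 2 * Real.sin (2 * T.angle d) =
      √(-T.discr) ^ 3 * (1 / |T.vertexProd v|) := by
  obtain ⟨d, rfl⟩ := T.exists_dart_fst_eq v
  have hsq : √(-T.discr) ^ 2 = -T.discr := Real.sq_sqrt (by linarith)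
  have p1 := T.absLabel_pos hD d
  have p2 := T.absLabel_pos hD d.symm
  have p3 := T.absLabel_pos hD (T.rot d)
  have hsl := T.slope_sq hD d
  rw [T.sum_outDarts, T.abs_vertexProd_fst, T.sin_two_mul_angle hD, T.sin_two_mul_angle hD,
    T.sin_two_mul_angle hD, slope_rot_rot, slope_rot, absLabel_rot_symm, absLabel_rot_symm,
    absLabel_rot_rot]
  rw [slope] at hsl ⊢
  rw [pow_succ, hsq]
  field_simp
  linear_combination -√(-T.discr) * hsl

theorem sum_sin_angle_sub_sin_angle (hD : T.discr < 0) (v : V) :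
    ∑ d ∈ T.outDarts v, (16 * Real.sin (2 * T.angle d) - 2 * Real.sin (4 * T.angle d)) =
      √(-T.discr) ^ 5 * (|T.vertexSum v| / |T.vertexProd v| ^ 2) := by
  obtain ⟨d, rfl⟩ := T.exists_dart_fst_eq v
  have hsq : √(-T.discr) ^ 2 = -T.discr := Real.sq_sqrt (by linarith)
  have p1 := T.absLabel_pos hD d
  have p2 := T.absLabel_pos hD d.symm
  have p3 := T.absLabel_pos hD (T.rot d)
  have hsl := T.slope_sq hD d
  have hterm : ∀ e, 16 * Real.sin (2 * T.angle e) - 2 * Real.sin (4 * T.angle e) =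
      √(-T.discr) * (6 * T.slope e / (T.absLabel e * T.absLabel e.symm) -
        T.discr * T.slope e / (T.absLabel e * T.absLabel e.symm) ^ 2) := by
    intro e
    have q1 := T.absLabel_pos hD e
    have q2 := T.absLabel_pos hD e.symm
    rw [show 4 * T.angle e = 2 * (2 * T.angle e) by ring, Real.sin_two_mul (2 * T.angle e),
      T.sin_two_mul_angle hD, T.cos_two_mul_angle hD]
    field_simp
    ring
  simp only [hterm]
  rw [T.sum_outDarts, T.abs_vertexProd_fst, T.abs_vertexSum_fst hD, slope_rot_rot, slope_rot,
    absLabel_rot_symm, absLabel_rot_symm, absLabel_rot_rot]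
  rw [slope] at hsl ⊢
  have hdisc : T.discr = (T.absLabel d + T.absLabel d.symm - T.absLabel (T.rot d)) ^ 2 -
      4 * (T.absLabel d * T.absLabel d.symm) := by linear_combination -hsl
  rw [show √(-T.discr) ^ 5 = √(-T.discr) * (√(-T.discr) ^ 2) ^ 2 by ring, hsq, hdisc]
  field_simp
  ring

end Topograph

/-! ### The two sums -/

theorem theorem9p1 {V : Type*} (T : Topograph V) (D : ℝ) (hT : T.discr = D) (hD : D < 0) :
    (∀ v : V, T.vertexProd v ≠ 0) ∧
    (Summable (fun v : V => 1 / |T.vertexProd v|) ∧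
      |D| ^ (3 / 2 : ℝ) * ∑' v : V, 1 / |T.vertexProd v| = 4 * Real.pi) ∧
    (Summable (fun v : V => |T.vertexSum v| / |T.vertexProd v| ^ 2) ∧
      |D| ^ (5 / 2 : ℝ) * ∑' v : V, |T.vertexSum v| / |T.vertexProd v| ^ 2 = 24 * Real.pi) := by
  subst hT
  have hΔ : 0 < √(-T.discr) := Real.sqrt_pos.2 (by linarith)
  have hpow : ∀ k : ℕ, |T.discr| ^ (k / 2 : ℝ) = √(-T.discr) ^ k := fun k => by
    rw [abs_of_neg hD, Real.sqrt_eq_rpow, ← Real.rpow_mul_natCast (by linarith)]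
    congr 1
    ring
  have hsin : ∀ k : ℝ, HasDerivAt (fun a => Real.sin (k * a)) k 0 := fun k => by
    simpa using ((hasDerivAt_id (0 : ℝ)).const_mul k).sin
  have hsin2 : ∀ a, Real.sin (2 * (Real.pi - a)) = -Real.sin (2 * a) := fun a => by
    rw [mul_sub, Real.sin_two_pi_sub]
  have hsin4 : ∀ a, Real.sin (4 * (Real.pi - a)) = -Real.sin (4 * a) := fun a => by
    rw [show 4 * (Real.pi - a) = 2 * Real.pi - 4 * a + 2 * Real.pi by ring, Real.sin_add_two_pi,
      Real.sin_two_pi_sub]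
  have h1 := T.hasSum_sum_comp_angle hD (g := fun a => 2 * Real.sin (2 * a)) (K := 4)
    (((hsin 2).const_mul 2).congr_deriv (by norm_num)) (by simp)
    (fun a => by simp only [hsin2]; ring)
    (fun v => by rw [T.sum_two_mul_sin_angle hD]; positivity)
  have h2 := T.hasSum_sum_comp_angle hD
    (g := fun a => 16 * Real.sin (2 * a) - 2 * Real.sin (4 * a)) (K := 24)
    ((((hsin 2).const_mul 16).sub ((hsin 4).const_mul 2)).congr_deriv (by norm_num)) (by simp)
    (fun a => by simp only [hsin2, hsin4]; ring)
    (fun v => by rw [T.sum_sin_angle_sub_sin_angle hD]; positivity)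
  simp only [T.sum_two_mul_sin_angle hD] at h1
  simp only [T.sum_sin_angle_sub_sin_angle hD] at h2
  have h3 := hpow 3
  have h5 := hpow 5
  push_cast at h3 h5
  refine ⟨fun v => ?_, ⟨?_, ?_⟩, ?_, ?_⟩
  · obtain ⟨d, rfl⟩ := T.exists_dart_fst_eq v
    have p1 := T.absLabel_pos hD d
    have p2 := T.absLabel_pos hD d.symm
    have p3 := T.absLabel_pos hD (T.rot d)
    rw [← abs_pos, T.abs_vertexProd_fst]
    positivity
  · exact (summable_mul_left_iff (pow_pos hΔ 3).ne').1 h1.summable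
  · rw [h3, ← tsum_mul_left, h1.tsum_eq]
  · exact (summable_mul_left_iff (pow_pos hΔ 5).ne').1 h2.summable
  · rw [h5, ← tsum_mul_left, h2.tsum_eq]
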